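/- Let $G=(\Psi,\mathcal E)$ be a finite directed acyclic graph whose nodes are random variables, $\Psi=(X,\Theta)$ with $X$ the observables and $\Theta$ the parameters, and suppose that the joint distribution of $\Psi$ has the density $p(\Psi)=\prod_{\psi\in\Psi}p(\psi\mid \mathrm{pa}(\psi))$ with respect to a product of $\sigma$-finite reference measures, where $p(\psi\mid\mathrm{pa}(\psi))$ is a conditional density of $\psi$ given its parents. Let $X=X_A^\ast\cup X_B^\ast$ with $X_A^\ast\cap X_B^\ast=\emptyset$. For $I\in\{A,B\}$ the module $\Psi_I\subseteq\Psi$ consists of $X_I^\ast$ and of the following nodes: for every directed path $\psi_s\to\psi_{s-1}\to\dots\to\psi_1$ with $s\ge 2$ and leaf $\psi_1\in X_I^\ast$, (1) the nodes $\psi_1,\dots,\psi_r$, if $r>1$, $\psi_r\in X\setminus X_I^\ast$ and $\psi_1,\dots,\psi_{r-1}\notin X\setminus X_I^\ast$; (2) all of $\psi_1,\dots,\psi_s$, if no node of the path is in $X\setminus X_I^\ast$. Write $\Psi_{A\setminus B}=\Psi_A\setminus\Psi_B$, $\Psi_{B\setminus A}=\Psi_B\setminus\Psi_A$ and $\Psi_{A\cap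 B}=\Psi_A\cap\Psi_B$. A path of $G$ (a sequence of distinct nodes in which consecutive nodes are joined by an edge of either orientation), with end points outside a set $T$, is blocked by $T$ if it has an interior node $\psi_j$ such that either $\psi_j\in T$ and not $\psi_{j-1}\to\psi_j\leftarrow\psi_{j+1}$, or $\psi_{j-1}\to\psi_j\leftarrow\psi_{j+1}$ and neither $\psi_j$ nor any descendant of $\psi_j$ is in $T$; $T$ d-separates two sets of nodes if it blocks every path from the one to the other. Then $\Psi_{A\setminus B}$ and $\Psi_{B\setminus A}$ are d-separated by $\Psi_{A\cap B}$ in $G$, and $\Psi_{A\setminus B}$ and $\Psi_{B\setminus A}$ are conditionally independent given $\Psi_{A\cap B}$. Furthermore, if the modules are unordered, that is, if $G$ has no edge from $\Psi_{A\cap B}$ to $\Psi_{B\setminus A}$ and no edge from $\Psi_{A\cap B}$ to $\Psi_{A\setminus B}$, then $\Psi_{A\cap B}=\emptyset$, and $\Psi_{A\setminus B}$ and $\Psi_{B\setminus A}$ are independent. -/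

import Mathlib

open MeasureTheory ProbabilityTheory
open scoped ENNReal

namespace CutModules

section Graph

variable {V : Type*}

/-- A directed graph without directed cycles. -/
def IsDAG (G : Digraph V) : Prop := ∀ v, ¬ Relation.TransGen G.Adj v v

/-- `p = [ψ₁, ψ₂, …, ψₛ]` lists the nodes of a directed path `b ⇝ a` between distinct nodes,
written from its leaf `ψ₁ = a` back to its root `ψₛ = b`: there is an edge from each node to the
one listed before it. -/
def IsDirectedPath (G : Digraph V) (b a : V) (p : List V) : Prop :=
  a ≠ b ∧ p.head? = some a ∧ p.getLast? = some b ∧ p.IsChain (fun c d => G.Adj d c)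

/-- The set of nodes that a directed path with nodes `p = [ψ₁, …, ψₛ]` (leaf first) contributes to
the module generated by the set `S` of observables, where `X` is the set of all observables.
First case: `p = init ++ r :: rest`, where `r` is the first node of the path in `X \ S`, and it is
not the leaf; the nodes up to and including `r` are added.
Second case: no node of the path is in `X \ S`; all its nodes are added. -/
def pathContribution (X S : Set V) (p : List V) : Set V :=
  {v | (∃ init r rest, p = init ++ r :: rest ∧ init ≠ [] ∧ r ∈ X \ S ∧
          (∀ u ∈ init, u ∉ X \ S) ∧ (v ∈ init ∨ v = r)) ∨
       ((∀ u ∈ p, u ∉ X \ S) ∧ v ∈ p)}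

/-- The module generated by a set `S ⊆ X` of observables: the set `S` itself, together with the
contributions of all directed paths whose leaf is in `S`. -/
def moduleOf (G : Digraph V) (X S : Set V) : Set V :=
  S ∪ {v | ∃ a ∈ S, ∃ b p, IsDirectedPath G b a p ∧ v ∈ pathContribution X S p}

/-- The relation `A ⇀ B` between two modules: there is an edge from `A ∩ B` to `B \ A`. -/
def Feeds (G : Digraph V) (A B : Set V) : Prop :=
  ∃ u ∈ A ∩ B, ∃ v ∈ B \ A, G.Adj u v

/-- Two modules are unordered if neither `A ⇀ B` nor `B ⇀ A`. -/
def Unordered (G : Digraph V) (A B : Set V) : Prop :=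
  ¬ Feeds G A B ∧ ¬ Feeds G B A

/-- `p` lists the distinct nodes of an undirected path from `a` to `b` (edges of either
orientation). -/
def IsPath (G : Digraph V) (a b : V) (p : List V) : Prop :=
  p.head? = some a ∧ p.getLast? = some b ∧ p.IsChain (fun c d => G.Adj c d ∨ G.Adj d c) ∧ p.Nodup

/-- A path `p` is blocked at an interior node `w` (with neighbours `u` and `v` on the path) by the
set `T`: either `w ∈ T` is not a collider on the path, or `w` is a collider and neither
`w` nor any of its descendants is in `T`. -/
def BlockedBy (G : Digraph V) (T : Set V) (p : List V) : Prop :=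
  ∃ l₁ u w v l₂, p = l₁ ++ u :: w :: v :: l₂ ∧
    ((w ∈ T ∧ ¬ (G.Adj u w ∧ G.Adj v w)) ∨
     ((G.Adj u w ∧ G.Adj v w) ∧ ∀ d, Relation.ReflTransGen G.Adj w d → d ∉ T))

/-- `T` d-separates `A` from `B`: every path from a node of `A` to a node of `B` has its end points
outside `T` and is blocked by `T`. -/
def DSeparates (G : Digraph V) (T A B : Set V) : Prop :=
  ∀ a ∈ A, ∀ b ∈ B, ∀ p, IsPath G a b p → a ∉ T ∧ b ∉ T ∧ BlockedBy G T p

end Graph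

section Probability

variable {V : Type*} {E : V → Type*} [∀ v, MeasurableSpace (E v)]

/-- The Markov factorization property of a joint distribution `P` of variables indexed by the nodes
of `G`: with respect to the product of the reference measures `ν v`, it has the density
`∏ v, k v (x_v | x_pa(v))`, where each `k v` is a conditional density of the variable at `v` given
the variables at the parents of `v`. -/
def MarkovFactorization [Fintype V] (G : Digraph V) (ν : ∀ v, Measure (E v))
    (P : Measure (∀ v, E v)) : Prop :=
  ∃ k : ∀ v, E v → (∀ u : {u // G.Adj u v}, E u) → ℝ≥0∞,
    (∀ v, Measurable (Function.uncurry (k v))) ∧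
    (∀ v y, ∫⁻ x, k v x y ∂(ν v) = 1) ∧
    P = (Measure.pi ν).withDensity (fun x => ∏ v, k v (x v) (fun u => x u))

/-- The random vector of those variables whose index is in `S`. -/
def subvector {Ω : Type*} (Y : ∀ v, Ω → E v) (S : Set V) : Ω → ∀ v : S, E v :=
  fun ω v => Y v ω

theorem measurable_subvector {Ω : Type*} [MeasurableSpace Ω] {Y : ∀ v, Ω → E v}
    (hY : ∀ v, Measurable (Y v)) (S : Set V) : Measurable (subvector Y S) :=
  measurable_pi_lambda _ (fun v => hY v)

/-- The random vectors of the variables in `S` and in `T` are conditionally independent given the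
variables in `C`. -/
def CondIndepGiven {Ω : Type*} [MeasurableSpace Ω] [StandardBorelSpace Ω]
    (P : Measure Ω) [IsFiniteMeasure P] (Y : ∀ v, Ω → E v) (hY : ∀ v, Measurable (Y v))
    (S T C : Set V) : Prop :=
  CondIndepFun (MeasurableSpace.comap (subvector Y C) inferInstance)
    (measurable_subvector hY C).comap_le (subvector Y S) (subvector Y T) P

end Probability

end CutModules

/-! A module generated by `S` is closed under passing to parents, except at nodes of `X \ S`. Hence
with `N = A \ XB` every node of `N` has its family (itself and its parents) in `A`, and every node
of `B \ N` has its family in `B`. Everything except the disjointness of unordered modules uses only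
this cover of families, `IsFamilyCover`.

Graph side: `A ∪ B` is ancestral, no edge joins `A \ B` to `B \ A`, and a child in `A ∩ B` of a node
of `A \ B` has all its parents in `A`. On a path from `A \ B` to `B \ A`, the nodes just after the
last visit to `A \ B` therefore provide a block (`IsFamilyCover.dSeparates`).

Probability side: the density is a product over `N`, a function on `A`, times a product over `B \
N`, a function on `B`, times the factors outside `A ∪ B`, which integrate to one because the graph
is acyclic (`lmarginal_prod_eq_one`). Such a factorization gives conditional independence given `A ∩
B` (`condIndepGiven_of_density`).

For unordered modules, a node of `A ∩ B` without descendants in `A ∩ B` would have a child in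
exactly one module (`inter_eq_empty_of_unordered`); conditioning on no variables is then plain
independence. -/

namespace CutModules

/-! ### Modules as sets of restricted ancestors -/

section Modules

variable {V : Type*} {G : Digraph V} {X S : Set V}

theorem IsDAG.wellFounded [Finite V] (hG : IsDAG G) :
    WellFounded (fun a b => Relation.TransGen G.Adj b a) := by
  have : IsTrans V (fun a b => Relation.TransGen G.Adj b a) := ⟨fun _ _ _ h₁ h₂ => h₂.trans h₁⟩
  have : Std.Irrefl (fun a b => Relation.TransGen G.Adj b a) := ⟨hG⟩
  exact Finite.wellFounded_of_trans_of_irrefl _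

theorem subset_moduleOf : S ⊆ moduleOf G X S := Set.subset_union_left

/-- Only the source of each step must avoid `N`: a walk may end in `N` but not continue past it.
This single condition covers both cases of `pathContribution`. -/
theorem reflTransGen_of_isChain {r : V → V → Prop} {N : Set V} :
    ∀ {l : List V} {l' : List V} {a v : V}, (l ++ v :: l').head? = some a →
      (l ++ v :: l').IsChain r → (∀ u ∈ l, u ∉ N) →
      Relation.ReflTransGen (fun c d => r c d ∧ c ∉ N) a v
  | [], l', a, v, hh, _, _ => by
      simp only [List.nil_append, List.head?_cons, Option.some.injEq] at hh
      exact hh ▸ .refl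
  | c :: l, l', a, v, hh, hc, hN => by
      simp only [List.cons_append, List.head?_cons, Option.some.injEq] at hh
      subst hh
      obtain ⟨b, hb⟩ : ∃ b, (l ++ v :: l').head? = some b := by
        cases l <;> simp
      rw [List.cons_append, List.isChain_cons] at hc
      exact .head ⟨hc.1 b hb, hN c (by simp)⟩
        (reflTransGen_of_isChain hb hc.2 fun u hu => hN u (by simp [hu]))

theorem exists_isChain_of_reflTransGen {r : V → V → Prop} {N : Set V} {a v : V}
    (h : Relation.ReflTransGen (fun c d => r c d ∧ c ∉ N) a v) :
    ∃ l : List V, (l ++ [v]).head? = some a ∧ (l ++ [v]).IsChain r ∧ ∀ u ∈ l, u ∉ N := by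
  induction h with
  | refl => exact ⟨[], by simp⟩
  | @tail b c _ hbc ih =>
    obtain ⟨l, hh, hc, hN⟩ := ih
    refine ⟨l ++ [b], ?_, ?_, ?_⟩
    · cases l <;> simp_all
    · rw [List.isChain_append]
      exact ⟨hc, by simp, by simpa using hbc.1⟩
    · intro u hu
      rcases List.mem_append.1 hu with hu | hu
      · exact hN u hu
      · rw [List.mem_singleton.1 hu]
        exact hbc.2

/-- A node is in the module generated by `S` if and only if it is connected to a node of `S` by a
directed walk on which all nodes but the first are outside `X \ S`. -/
theorem mem_moduleOf_iff {v : V} :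
    v ∈ moduleOf G X S ↔
      ∃ a ∈ S, Relation.ReflTransGen (fun c d => G.Adj d c ∧ c ∉ X \ S) a v := by
  constructor
  · rintro (hv | ⟨a, ha, b, p, ⟨-, hh, -, hc⟩, hv⟩)
    · exact ⟨v, hv, .refl⟩
    · refine ⟨a, ha, ?_⟩
      rcases hv with ⟨init, r, rest, rfl, -, -, hN, hv | rfl⟩ | ⟨hN, hv⟩
      · obtain ⟨l, l', rfl⟩ := List.append_of_mem hv
        rw [List.append_assoc] at hh hc
        exact reflTransGen_of_isChain hh hc fun u hu => hN u (by simp [hu])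
      · exact reflTransGen_of_isChain hh hc hN
      · obtain ⟨l, l', rfl⟩ := List.append_of_mem hv
        exact reflTransGen_of_isChain hh hc fun u hu => hN u (by simp [hu])
  · rintro ⟨a, ha, h⟩
    obtain ⟨l, hh, hc, hN⟩ := exists_isChain_of_reflTransGen h
    by_cases hva : a = v
    · exact Or.inl (hva ▸ ha)
    -- The nodes of a directed path need not be listed without repetition, so the walk itself serves
    -- as the path.
    refine Or.inr ⟨a, ha, v, l ++ [v], ⟨hva, hh, by simp, hc⟩, ?_⟩
    by_cases hv : v ∈ X \ S
    · refine Or.inl ⟨l, v, [], rfl, ?_, hv, hN, Or.inr rfl⟩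
      rintro rfl
      simp at hh
      exact hva hh.symm
    · refine Or.inr ⟨fun u hu => ?_, by simp⟩
      rcases List.mem_append.1 hu with hu | hu
      · exact hN u hu
      · rwa [List.mem_singleton.1 hu]

theorem parent_mem_moduleOf {u v : V} (huv : G.Adj u v) (hv : v ∈ moduleOf G X S)
    (hvS : v ∉ X \ S) : u ∈ moduleOf G X S := by
  obtain ⟨a, ha, h⟩ := mem_moduleOf_iff.1 hv
  exact mem_moduleOf_iff.2 ⟨a, ha, h.tail ⟨huv, hvS⟩⟩

theorem exists_child_mem_moduleOf {v : V} (hv : v ∈ moduleOf G X S) (hvS : v ∉ S) :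
    ∃ w, G.Adj v w ∧ w ∈ moduleOf G X S := by
  obtain ⟨a, ha, h⟩ := mem_moduleOf_iff.1 hv
  rcases h.cases_tail with rfl | ⟨w, hw, hvw⟩
  · exact absurd ha hvS
  · exact ⟨w, hvw.1, mem_moduleOf_iff.2 ⟨a, ha, hw⟩⟩

/-- Two sets of nodes `A` and `B` cover the families of the nodes in `A ∪ B`: the family of a node
in `N ⊆ A` is contained in `A`, the family of any other node of `A ∪ B` is contained in `B`. -/
structure IsFamilyCover (G : Digraph V) (A B N : Set V) : Prop where
  subset_left : N ⊆ A
  diff_subset : A \ B ⊆ N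
  parent_left : ∀ {u v}, G.Adj u v → v ∈ N → u ∈ A
  parent_right : ∀ {u v}, G.Adj u v → v ∈ B → v ∉ N → u ∈ B

theorem isFamilyCover_moduleOf {XA XB : Set V} (hdisj : Disjoint XA XB) (hunion : XA ∪ XB = X) :
    IsFamilyCover G (moduleOf G X XA) (moduleOf G X XB) (moduleOf G X XA \ XB) where
  subset_left := Set.sdiff_subset
  diff_subset := fun _ hv => ⟨hv.1, fun h => hv.2 (subset_moduleOf h)⟩
  parent_left := fun huv hv => parent_mem_moduleOf huv hv.1 fun h => by
    rw [← hunion] at h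
    exact h.1.elim h.2 hv.2
  parent_right := fun huv hv hvN => parent_mem_moduleOf huv hv fun h => by
    rw [← hunion] at h
    have hA := h.1.resolve_right h.2
    exact hvN ⟨subset_moduleOf hA, Set.disjoint_left.1 hdisj hA⟩

/-- Unordered modules generated by disjoint sets of observables are disjoint. -/
theorem inter_eq_empty_of_unordered [Finite V] (hG : IsDAG G) {XA XB : Set V}
    (hdisj : Disjoint XA XB)
    (h : Unordered G (moduleOf G X XA) (moduleOf G X XB)) :
    moduleOf G X XA ∩ moduleOf G X XB = ∅ := by
  by_contra hne
  obtain ⟨v, hv, hmax⟩ := hG.wellFounded.has_min _ (Set.nonempty_iff_ne_empty.2 hne)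
  -- `v` lies in at most one of `XA`, `XB`, so in one of the modules it is not a generator and has a
  -- child there. By the choice of `v`, that child is not in the other module.
  by_cases hvA : v ∈ XA
  · obtain ⟨w, hvw, hw⟩ := exists_child_mem_moduleOf hv.2 (Set.disjoint_left.1 hdisj hvA)
    exact h.1 ⟨v, hv, w, ⟨hw, fun hw' => hmax w ⟨hw', hw⟩ (.single hvw)⟩, hvw⟩
  · obtain ⟨w, hvw, hw⟩ := exists_child_mem_moduleOf hv.1 hvA
    exact h.2 ⟨v, hv.symm, w, ⟨hw, fun hw' => hmax w ⟨hw, hw'⟩ (.single hvw)⟩, hvw⟩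

end Modules

/-! ### d-separation from a cover of families -/

section Separation

variable {V : Type*} {G : Digraph V} {A B N T : Set V}

theorem BlockedBy.append_left {p : List V} (h : BlockedBy G T p) (l : List V) :
    BlockedBy G T (l ++ p) := by
  obtain ⟨l₁, u, w, v, l₂, rfl, hb⟩ := h
  exact ⟨l ++ l₁, u, w, v, l₂, by simp, hb⟩

theorem BlockedBy.cons {p : List V} (h : BlockedBy G T p) (u : V) : BlockedBy G T (u :: p) :=
  h.append_left [u]

theorem IsDAG.not_adj_of_adj (hG : IsDAG G) {u v : V} (h : G.Adj u v) : ¬ G.Adj v u :=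
  fun h' => hG u (.tail (.single h) h')

theorem not_mem_of_reflTransGen {C : Set V} (hC : ∀ {u v}, G.Adj u v → v ∈ C → u ∈ C) {w d : V}
    (h : Relation.ReflTransGen G.Adj w d) (hw : w ∉ C) : d ∉ C := by
  induction h with
  | refl => exact hw
  | tail _ hbc ih => exact fun hc => ih (hC hbc hc)

/-- A path that leaves an ancestral set containing `T` along an edge and returns to it later is
blocked by `T`. -/
theorem blockedBy_of_leaves_ancestral {C : Set V} (hC : ∀ {u v}, G.Adj u v → v ∈ C → u ∈ C)
    (hT : T ⊆ C) {b : V} (hb : b ∈ C) :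
    ∀ {r : List V} {u w : V}, G.Adj u w → w ∉ C → (w :: r).getLast? = some b →
      (w :: r).IsChain (fun c d => G.Adj c d ∨ G.Adj d c) → BlockedBy G T (u :: w :: r)
  | [], u, w, _, hw, hl, _ => by
      simp only [List.getLast?_singleton, Option.some.injEq] at hl
      exact absurd (hl ▸ hb) hw
  | v :: r, u, w, huw, hw, hl, hc => by
      rw [List.isChain_cons_cons] at hc
      -- Either the path turns back at `w`, a collider whose descendants all stay outside `C`, or it
      -- continues to `v`, again outside `C`. As it ends in `C`, it must turn back somewhere.
      by_cases hvw : G.Adj v w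
      · exact ⟨[], u, w, v, r, rfl, Or.inr ⟨⟨huw, hvw⟩, fun d hd hdT =>
          not_mem_of_reflTransGen hC hd hw (hT hdT)⟩⟩
      · have hwv := hc.1.resolve_right hvw
        exact (blockedBy_of_leaves_ancestral hC hT hb hwv (fun hv => hw (hC hwv hv))
          (by simpa using hl) hc.2).cons u

theorem exists_last_mem {S : Set V} : ∀ {p : List V}, (∃ a ∈ p, a ∈ S) →
    ∃ l u r, p = l ++ u :: r ∧ u ∈ S ∧ ∀ v ∈ r, v ∉ S
  | [], h => by simp at h
  | c :: p, h => by
      by_cases hp : ∃ a ∈ p, a ∈ S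
      · obtain ⟨l, u, r, rfl, hu, hr⟩ := exists_last_mem hp
        exact ⟨c :: l, u, r, rfl, hu, hr⟩
      · push Not at hp
        obtain ⟨a, ha, haS⟩ := h
        rcases List.mem_cons.1 ha with rfl | ha
        · exact ⟨[], a, p, rfl, haS, hp⟩
        · exact absurd haS (hp a ha)

namespace IsFamilyCover

theorem mem_union_of_adj (h : IsFamilyCover G A B N) {u v : V} (huv : G.Adj u v)
    (hv : v ∈ A ∪ B) : u ∈ A ∪ B := by
  by_cases hN : v ∈ N
  · exact Or.inl (h.parent_left huv hN)
  · refine Or.inr (h.parent_right huv ?_ hN)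
    by_contra hB
    exact hN (h.diff_subset ⟨hv.resolve_right hB, hB⟩)

theorem not_adj (h : IsFamilyCover G A B N) {u v : V} (hu : u ∈ A \ B) (hv : v ∈ B \ A) :
    ¬ (G.Adj u v ∨ G.Adj v u) := by
  rintro (huv | hvu)
  · exact hu.2 (h.parent_right huv hv.1 fun hN => hv.2 (h.subset_left hN))
  · exact hv.2 (h.parent_left hvu (h.diff_subset hu))

/-- The parent `u` outside `B` forces `w ∈ N`, so the other parents of `w` lie in `A` too. -/
theorem mem_left_of_adj (h : IsFamilyCover G A B N) {u v w : V} (hu : u ∈ A \ B)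
    (huw : G.Adj u w) (hw : w ∈ A ∩ B) (hvw : G.Adj v w) : v ∈ A := by
  by_cases hN : w ∈ N
  · exact h.parent_left hvw hN
  · exact absurd (h.parent_right huw hw.2 hN) hu.2

/-- Two sets that cover the families of the nodes in their union are d-separated by their
intersection. -/
theorem dSeparates (hG : IsDAG G) (h : IsFamilyCover G A B N) :
    DSeparates G (A ∩ B) (A \ B) (B \ A) := by
  rintro a ha b hb p ⟨hh, hl, hc, -⟩
  refine ⟨fun h => ha.2 h.2, fun h => hb.2 h.1, ?_⟩
  obtain ⟨l, u, r, rfl, hu, hr⟩ := exists_last_mem ⟨a, List.mem_of_mem_head? hh, ha⟩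
  refine BlockedBy.append_left ?_ l
  have hl' : (u :: r).getLast? = some b := by
    rw [← hl, List.getLast?_append_of_ne_nil _ (List.cons_ne_nil _ _)]
  replace hc := (List.isChain_append.1 hc).2.1
  clear hh hl
  match r, hr, hl', hc with
  | [], _, hl, _ =>
    simp only [List.getLast?_singleton, Option.some.injEq] at hl
    exact absurd (hl ▸ hb.1) hu.2
  | w :: r, hr, hl, hc =>
    rw [List.getLast?_cons_cons] at hl
    rw [List.isChain_cons_cons] at hc
    by_cases hwC : w ∈ A ∪ B
    · have hwB : w ∈ B := by
        by_contra hwB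
        exact hr w (by simp) ⟨hwC.resolve_right hwB, hwB⟩
      have hwA : w ∈ A := by
        by_contra hwA
        exact h.not_adj hu ⟨hwB, hwA⟩ hc.1
      match r, hr, hl, hc with
      | [], _, hl, _ =>
        simp only [List.getLast?_singleton, Option.some.injEq] at hl
        exact absurd (hl ▸ hwA) hb.2
      | v :: r, hr, hl, hc =>
        -- If `w` is a collider it does not block, but then `v` lies in `A ∩ B` and is not the end
        -- point; since `v → w`, acyclicity makes `v` a non-collider, and it blocks.
        by_cases hcol : G.Adj u w ∧ G.Adj v w
        · have hvA := h.mem_left_of_adj hu hcol.1 ⟨hwA, hwB⟩ hcol.2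
          have hvB : v ∈ B := by
            by_contra hvB
            exact hr v (by simp) ⟨hvA, hvB⟩
          match r, hl with
          | [], hl =>
            simp only [List.getLast?_cons_cons, List.getLast?_singleton, Option.some.injEq] at hl
            exact absurd (hl ▸ hvA) hb.2
          | z :: r, _ =>
            exact ⟨[u], w, v, z, r, rfl, Or.inl ⟨⟨hvA, hvB⟩, fun hv =>
              hG.not_adj_of_adj hcol.2 hv.1⟩⟩
        · exact ⟨[], u, w, v, r, rfl, Or.inl ⟨⟨hwA, hwB⟩, hcol⟩⟩
    · refine blockedBy_of_leaves_ancestral h.mem_union_of_adj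
        (Set.inter_subset_left.trans Set.subset_union_left) (Or.inr hb.1) ?_ hwC hl hc.2
      exact hc.1.resolve_right fun hwu => hwC (h.mem_union_of_adj hwu (Or.inl hu.1))

end IsFamilyCover

end Separation

/-! ### Functions depending on a subset of the coordinates -/

section DependsOn

variable {ι : Type*} {α : ι → Type*} {s : Set ι} {a b : (∀ i, α i) → ℝ≥0∞}

theorem dependsOn_mul (ha : DependsOn a s) (hb : DependsOn b s) :
    DependsOn (fun x => a x * b x) s := fun _ _ h => by
  simp only [ha h, hb h]

theorem dependsOn_div (ha : DependsOn a s) (hb : DependsOn b s) :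
    DependsOn (fun x => a x / b x) s := fun _ _ h => by
  simp only [ha h, hb h]

theorem dependsOn_prod {κ : Type*} {t : Finset κ} {d : κ → (∀ i, α i) → ℝ≥0∞}
    (h : ∀ k ∈ t, DependsOn (d k) s) : DependsOn (fun x => ∏ k ∈ t, d k x) s :=
  fun _ _ hxy => Finset.prod_congr rfl fun k hk => h k hk hxy

end DependsOn

/-! ### Integrating out coordinates -/

section Marginal

variable {V : Type*} [DecidableEq V] {E : V → Type*} [∀ v, MeasurableSpace (E v)]
  {ν : ∀ v, Measure (E v)}

theorem lmarginal_mul_left {s : Set V} {t : Finset V} {a b : (∀ v, E v) → ℝ≥0∞}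
    (ha : DependsOn a s) (hst : Disjoint s t) (hb : Measurable b) :
    ∫⋯∫⁻_t, (fun x => a x * b x) ∂ν = fun x => a x * (∫⋯∫⁻_t, b ∂ν) x := by
  ext x
  have h : ∀ y, a (Function.updateFinset x t y) = a x := fun y => ha fun i hi => by
    simp [Function.updateFinset, Finset.mem_coe.not.1 (Set.disjoint_left.1 hst hi)]
  simp only [lmarginal, h]
  exact lintegral_const_mul _ (hb.comp measurable_updateFinset)

theorem lmarginal_mul_right {s : Set V} {t : Finset V} {a b : (∀ v, E v) → ℝ≥0∞}
    (hb : DependsOn b s) (hst : Disjoint s t) (ha : Measurable a) :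
    ∫⋯∫⁻_t, (fun x => a x * b x) ∂ν = fun x => (∫⋯∫⁻_t, a ∂ν) x * b x := by
  simp only [mul_comm _ (b _)]
  exact lmarginal_mul_left hb hst ha

theorem dependsOn_lmarginal {s : Set V} {t : Finset V} {a : (∀ v, E v) → ℝ≥0∞}
    (ha : DependsOn a (s ∪ t)) : DependsOn (∫⋯∫⁻_t, a ∂ν) s := fun x y h => by
  refine lintegral_congr fun z => ha fun i hi => ?_
  by_cases hit : i ∈ t
  · simp [Function.updateFinset, hit]
  · simpa [Function.updateFinset, hit] using h i (hi.resolve_right (by simpa using hit))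

/-- A product of conditional densities along the nodes of a directed acyclic graph has integral
one. -/
theorem lmarginal_prod_eq_one [Finite V] [∀ v, SigmaFinite (ν v)] {G : Digraph V} (hG : IsDAG G)
    {d : V → (∀ v, E v) → ℝ≥0∞} (hd : ∀ v, Measurable (d v))
    (hdep : ∀ v, DependsOn (d v) (insert v {u | G.Adj u v}))
    (hone : ∀ v x, ∫⁻ t, d v (Function.update x v t) ∂ν v = 1) (s : Finset V) :
    ∫⋯∫⁻_s, (fun x => ∏ v ∈ s, d v x) ∂ν = fun _ => 1 := by
  induction s using Finset.strongInduction with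
  | H s ih =>
    rcases s.eq_empty_or_nonempty with rfl | hne
    · simp
    -- `v` has no descendant in `s`, so no other factor involves its coordinate and it can be
    -- integrated out first.
    obtain ⟨v, hv, hmax⟩ := hG.wellFounded.has_min (s : Set V) hne
    replace hv : v ∈ s := hv
    have hmeas : ∀ t : Finset V, Measurable fun x => ∏ u ∈ t, d u x := fun t =>
      Finset.measurable_fun_prod t fun u _ => hd u
    rw [lmarginal_erase' _ (hmeas s) hv]
    have key : (fun x => ∫⁻ t, ∏ u ∈ s, d u (Function.update x v t) ∂ν v) =
        fun x => ∏ u ∈ s.erase v, d u x := by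
      ext x
      have h : ∀ t, ∏ u ∈ s, d u (Function.update x v t) =
          d v (Function.update x v t) * ∏ u ∈ s.erase v, d u x := fun t => by
        rw [← Finset.mul_prod_erase s _ hv]
        congr 1
        refine Finset.prod_congr rfl fun u hu => hdep u fun i hi => ?_
        have : i ≠ v := by
          rintro rfl
          rcases hi with rfl | hi
          · simp at hu
          · exact hmax u (Finset.mem_of_mem_erase hu) (.single hi)
        simp [this]
      simp only [h]
      rw [lintegral_mul_const _ (by exact (hd v).comp (measurable_update x)), hone, one_mul]
    rw [key]
    exact ih _ (Finset.erase_ssubset hv)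

/-- With the coordinates in `T` held fixed, `a` and `b` involve disjoint sets of variables, so
Fubini splits the inner integral. The base point `x₀` is immaterial, since every coordinate is
integrated. -/
theorem lintegral_pi_mul_mul [Fintype V] [∀ v, SigmaFinite (ν v)] {S U T R : Finset V}
    (hSU : Disjoint S U) (hST : Disjoint S T) (hUT : Disjoint U T) (hR : R = (T ∪ (S ∪ U))ᶜ)
    {a b h : (∀ v, E v) → ℝ≥0∞}
    (ha : Measurable a) (hb : Measurable b) (hh : Measurable h)
    (hadep : DependsOn a (T ∪ S : Set V)) (hbdep : DependsOn b (T ∪ U : Set V))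
    (hone : ∫⋯∫⁻_R, h ∂ν = fun _ => 1) (x₀ : ∀ v, E v) :
    ∫⁻ x, a x * b x * h x ∂(Measure.pi ν) =
      (∫⋯∫⁻_T, (fun x => (∫⋯∫⁻_S, a ∂ν) x * (∫⋯∫⁻_U, b ∂ν) x) ∂ν) x₀ := by
  have huniv : (Finset.univ : Finset V) = (T ∪ (S ∪ U)) ∪ R := by
    rw [hR, Finset.union_compl]
  have hab : Measurable fun x => a x * b x := ha.mul hb
  have hm : Measurable fun x => a x * b x * h x := hab.mul hh
  rw [lintegral_eq_lmarginal_univ x₀, huniv,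
    lmarginal_union ν _ hm (hR ▸ disjoint_compl_right)]
  have h₁ : ∫⋯∫⁻_R, (fun x => a x * b x * h x) ∂ν = fun x => a x * b x := by
    rw [lmarginal_mul_left (a := fun x => a x * b x) (s := (T ∪ (S ∪ U) : Set V)) _ _ hh, hone]
    · simp
    · exact dependsOn_mul (hadep.mono (by grind)) (hbdep.mono (by grind))
    · rw [hR, Set.disjoint_left]
      intro i hi
      simp only [Set.mem_union, SetLike.mem_coe, Finset.mem_compl, Finset.mem_union] at hi ⊢
      tauto
  have hTSU : Disjoint T (S ∪ U) := Finset.disjoint_union_right.2 ⟨hST.symm, hUT.symm⟩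
  rw [h₁, lmarginal_union ν _ hab hTSU, lmarginal_union ν _ hab hSU,
    lmarginal_mul_left hadep _ hb,
    lmarginal_mul_right (dependsOn_lmarginal hbdep) (by simpa using hST.symm) ha]
  rw [Set.disjoint_union_left]
  exact ⟨by simpa using hUT.symm, by simpa using hSU⟩

end Marginal

/-! ### Recognizing a conditional probability -/

section CondExp

variable {Ω : Type*} {m m0 : MeasurableSpace Ω} {P : Measure Ω} [IsFiniteMeasure P]

theorem toReal_ae_eq_condExp_indicator (hm : m ≤ m0) {D : Set Ω} (hD : MeasurableSet D)
    {q : Ω → ℝ≥0∞} (hq : Measurable[m] q)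
    (h : ∀ s, MeasurableSet[m] s → ∫⁻ ω in s, q ω ∂P = P (s ∩ D)) :
    (fun ω => (q ω).toReal) =ᵐ[P] P⟦D | m⟧ := by
  have hq0 : Measurable q := hq.mono hm le_rfl
  have hfin : ∫⁻ ω, q ω ∂P ≠ ∞ := by
    have := h Set.univ MeasurableSet.univ
    rw [Measure.restrict_univ] at this
    rw [this]
    exact measure_ne_top _ _
  refine ae_eq_condExp_of_forall_setIntegral_eq hm ((integrable_const 1).indicator hD)
    (fun s _ _ => (integrable_toReal_of_lintegral_ne_top hq0.aemeasurable hfin).integrableOn)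
    (fun s hs _ => ?_) hq.ennreal_toReal.stronglyMeasurable.aestronglyMeasurable
  rw [integral_toReal hq0.aemeasurable.restrict (ae_restrict_of_ae (ae_lt_top hq0 hfin)), h s hs,
    setIntegral_indicator hD]
  simp [Measure.real]

end CondExp

/-! ### From factorization to conditional independence -/

section Independence

variable {V : Type*} {E : V → Type*} [∀ v, MeasurableSpace (E v)]

theorem div_mul_div_mul_mul {a b c d : ℝ≥0∞} (hac : a ≤ c) (hbd : b ≤ d) (h : c * d ≠ ∞) :
    a / c * (b / d) * (c * d) = a * b := by
  rcases eq_or_ne c 0 with rfl | hc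
  · simp [nonpos_iff_eq_zero.1 hac]
  rcases eq_or_ne d 0 with rfl | hd
  · simp [nonpos_iff_eq_zero.1 hbd]
  have hc' : c ≠ ∞ := by
    rintro rfl
    simp [hd] at h
  have hd' : d ≠ ∞ := by
    rintro rfl
    simp [hc] at h
  rw [mul_mul_mul_comm, ENNReal.div_mul_cancel hc hc', ENNReal.div_mul_cancel hd hd']

/-- The values `0` and `∞` of `c` are harmless because both sides are then `0`. Thus the product
formula for `q` below holds pointwise, without exceptional null sets. -/
theorem div_mul_div_self {a c : ℝ≥0∞} (hac : a ≤ c) : a / c * (c / c) = a / c := by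
  rcases eq_or_ne c 0 with rfl | hc
  · simp [nonpos_iff_eq_zero.1 hac]
  rcases eq_or_ne c ∞ with rfl | hc'
  · simp
  · rw [ENNReal.div_self hc hc', mul_one]

theorem measurable_comap_subvector {Ω : Type*} [DecidableEq V] {Y : ∀ v, Ω → E v} {T : Finset V}
    {q : (∀ v, E v) → ℝ≥0∞} (hq : Measurable q) (hdep : DependsOn q T) (x₀ : ∀ v, E v) :
    Measurable[MeasurableSpace.comap (subvector Y T) inferInstance]
      fun ω => q (fun v => Y v ω) := by
  -- Freezing the coordinates outside `T` at `x₀` exhibits the function as one of `subvector Y T`.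
  have h : (fun ω => q (fun v => Y v ω)) =
      (fun t : ∀ v : (T : Set V), E v => q (Function.updateFinset x₀ T t)) ∘ subvector Y T := by
    ext ω
    refine hdep fun i hi => ?_
    simp [Function.updateFinset, Finset.mem_coe.1 hi, subvector]
  rw [h]
  exact (hq.comp measurable_updateFinset).comp (comap_measurable _)

/-- If the joint distribution has a density that is the product of a function of the variables in
`T ∪ S`, a function of the variables in `T ∪ U`, and a conditional density of the remaining
variables, then the variables in `S` and in `U` are conditionally independent given those
in `T`. -/
theorem condIndepGiven_of_density [Fintype V] [DecidableEq V]
    (ν : ∀ v, Measure (E v)) [∀ v, SigmaFinite (ν v)]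
    {Ω : Type*} [MeasurableSpace Ω] [StandardBorelSpace Ω] (P : Measure Ω) [IsProbabilityMeasure P]
    (Y : ∀ v, Ω → E v) (hY : ∀ v, Measurable (Y v)) {S U T R : Finset V}
    (hSU : Disjoint S U) (hST : Disjoint S T) (hUT : Disjoint U T) (hR : R = (T ∪ (S ∪ U))ᶜ)
    {f g h : (∀ v, E v) → ℝ≥0∞}
    (hf : Measurable f) (hg : Measurable g) (hh : Measurable h)
    (hfdep : DependsOn f (T ∪ S : Set V)) (hgdep : DependsOn g (T ∪ U : Set V))
    (hone : ∫⋯∫⁻_R, h ∂ν = fun _ => 1)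
    (hP : P.map (fun ω v => Y v ω) = (Measure.pi ν).withDensity (fun x => f x * g x * h x)) :
    CondIndepGiven P Y hY S U T := by
  obtain ⟨ω₀⟩ := P.nonempty_of_neZero
  let x₀ : ∀ v, E v := fun v => Y v ω₀
  have hYm : Measurable fun ω v => Y v ω := measurable_pi_lambda _ hY
  let r : ∀ W : Finset V, (∀ v, E v) → ∀ v : (W : Set V), E v := fun W x v => x v
  have hr : ∀ W, Measurable (r W) := fun W => measurable_pi_lambda _ fun v => measurable_pi_apply _
  have hrdep : ∀ (W : Finset V) (s : Set (∀ v : (W : Set V), E v)),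
      DependsOn (fun x => s.indicator (1 : (∀ v : (W : Set V), E v) → ℝ≥0∞) (r W x)) (W : Set V) := fun W s x y hxy => by
    have : r W x = r W y := funext fun v => hxy v v.2
    simp only [this]
  have hrm : ∀ (W : Finset V) {s : Set (∀ v : (W : Set V), E v)}, MeasurableSet s →
      Measurable fun x => s.indicator (1 : (∀ v : (W : Set V), E v) → ℝ≥0∞) (r W x) := fun W s hs =>
    (measurable_one.indicator hs).comp (hr W)
  let F : Set (∀ v : (S : Set V), E v) → (∀ v, E v) → ℝ≥0∞ := fun s =>
    ∫⋯∫⁻_S, (fun x => s.indicator 1 (r S x) * f x) ∂ν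
  let H : Set (∀ v : (U : Set V), E v) → (∀ v, E v) → ℝ≥0∞ := fun t =>
    ∫⋯∫⁻_U, (fun x => t.indicator 1 (r U x) * g x) ∂ν
  have hFm : ∀ {s}, MeasurableSet s → Measurable (F s) := fun hs => ((hrm S hs).mul hf).lmarginal ν
  have hHm : ∀ {t}, MeasurableSet t → Measurable (H t) := fun ht => ((hrm U ht).mul hg).lmarginal ν
  have hfdep' : ∀ s : Set (∀ v : (S : Set V), E v),
      DependsOn (fun x => s.indicator 1 (r S x) * f x) (T ∪ S : Set V) := fun s =>
    dependsOn_mul ((hrdep S s).mono Set.subset_union_right) hfdep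
  have hgdep' : ∀ s : Set (∀ v : (U : Set V), E v),
      DependsOn (fun x => s.indicator 1 (r U x) * g x) (T ∪ U : Set V) := fun s =>
    dependsOn_mul ((hrdep U s).mono Set.subset_union_right) hgdep
  have hFdep : ∀ s, DependsOn (F s) T := fun s => dependsOn_lmarginal (hfdep' s)
  have hHdep : ∀ t, DependsOn (H t) T := fun t => dependsOn_lmarginal (hgdep' t)
  have hFle : ∀ s x, F s x ≤ F Set.univ x := fun s => lmarginal_mono fun x => by
    dsimp only
    gcongr
    exact Set.subset_univ s
  have hHle : ∀ t x, H t x ≤ H Set.univ x := fun t => lmarginal_mono fun x => by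
    dsimp only
    gcongr
    exact Set.subset_univ t
  have key : ∀ {u : (∀ v, E v) → ℝ≥0∞} {s t}, Measurable u → DependsOn u T →
      MeasurableSet s → MeasurableSet t →
      ∫⁻ ω, u (fun v => Y v ω) * s.indicator 1 (subvector Y S ω) *
          t.indicator 1 (subvector Y U ω) ∂P =
        (∫⋯∫⁻_T, (fun x => u x * (F s x * H t x)) ∂ν) x₀ := by
    intro u s t hu hudep hs ht
    have hm : Measurable fun x => u x * s.indicator 1 (r S x) * t.indicator 1 (r U x) :=
      (hu.mul (hrm S hs)).mul (hrm U ht)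
    have hd : Measurable fun x => f x * g x * h x := (hf.mul hg).mul hh
    have hsf : Measurable fun x => s.indicator 1 (r S x) * f x := (hrm S hs).mul hf
    have htg : Measurable fun x => t.indicator 1 (r U x) * g x := (hrm U ht).mul hg
    calc _ = ∫⁻ x, u x * s.indicator 1 (r S x) * t.indicator 1 (r U x)
            ∂(P.map (fun ω v => Y v ω)) := (lintegral_map hm hYm).symm
      _ = ∫⁻ x, (u x * (s.indicator 1 (r S x) * f x)) * (t.indicator 1 (r U x) * g x) * h x
            ∂(Measure.pi ν) := by
          rw [hP, lintegral_withDensity_eq_lintegral_mul _ hd hm]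
          refine lintegral_congr fun x => ?_
          simp only [Pi.mul_apply]
          ring
      _ = _ := by
          have husf : Measurable fun x => u x * (s.indicator 1 (r S x) * f x) := hu.mul hsf
          rw [lintegral_pi_mul_mul hSU hST hUT hR husf htg hh
            (dependsOn_mul (hudep.mono Set.subset_union_left) (hfdep' s)) (hgdep' t) hone x₀,
            lmarginal_mul_left hudep (by simpa using hST.symm) hsf]
          simp only [mul_assoc, F, H]
  -- `F univ * H univ` is the density of the variables in `T`; its integral is the total mass one,
  -- so it is finite almost everywhere.
  have hfin : ∀ᵐ y ∂(Measure.pi fun i : T => ν i),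
      F Set.univ (Function.updateFinset x₀ T y) * H Set.univ (Function.updateFinset x₀ T y) < ∞ := by
    have h1 := key (u := fun _ => 1) measurable_const (fun _ _ _ => rfl) .univ .univ
    simp only [Set.indicator_univ, Pi.one_apply, mul_one, one_mul, lintegral_const,
      measure_univ] at h1
    refine ae_lt_top (((hFm .univ).mul (hHm .univ)).comp measurable_updateFinset) ?_
    change (∫⋯∫⁻_T, (fun x => F Set.univ x * H Set.univ x) ∂ν) x₀ ≠ ∞
    rw [← h1]
    exact ENNReal.one_ne_top
  -- The candidate for the conditional probability of the two events given the variables in `T`: a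
  -- ratio of marginals for `S` times one for `U`.
  let q : Set (∀ v : (S : Set V), E v) → Set (∀ v : (U : Set V), E v) → (∀ v, E v) → ℝ≥0∞ :=
    fun s t x => F s x / F Set.univ x * (H t x / H Set.univ x)
  have hqm : ∀ {s t}, MeasurableSet s → MeasurableSet t → Measurable (q s t) := fun hs ht =>
    ((hFm hs).div (hFm .univ)).mul ((hHm ht).div (hHm .univ))
  have hqdep : ∀ s t, DependsOn (q s t) T := fun s t =>
    dependsOn_mul (dependsOn_div (hFdep _) (hFdep _)) (dependsOn_div (hHdep _) (hHdep _))
  have hcond : ∀ {s t}, MeasurableSet s → MeasurableSet t →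
      (fun ω => (q s t (fun v => Y v ω)).toReal) =ᵐ[P]
        P⟦subvector Y S ⁻¹' s ∩ subvector Y U ⁻¹' t |
          MeasurableSpace.comap (subvector Y T) inferInstance⟧ := by
    intro s t hs ht
    have hD₁ := measurable_subvector hY S hs
    have hD₂ := measurable_subvector hY U ht
    refine toReal_ae_eq_condExp_indicator (measurable_subvector hY T).comap_le (hD₁.inter hD₂)
      (measurable_comap_subvector (hqm hs ht) (hqdep s t) x₀) ?_
    rintro _ ⟨C, hC, rfl⟩
    have hC' := measurable_subvector hY T hC
    have hu := hrm T hC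
    have e₁ := key hu (hrdep T C) hs ht
    have e₂ := key (hu.mul (hqm hs ht)) (dependsOn_mul (hrdep T C) (hqdep s t)) .univ .univ
    -- Multiplying `q s t` by the density of the `T`-variables cancels the denominators; where one
    -- vanishes, its numerator vanishes as well.
    have e₃ : (∫⋯∫⁻_T, (fun x => C.indicator 1 (r T x) * q s t x *
        (F Set.univ x * H Set.univ x)) ∂ν) x₀ =
        (∫⋯∫⁻_T, (fun x => C.indicator 1 (r T x) * (F s x * H t x)) ∂ν) x₀ := by
      refine lintegral_congr_ae ?_
      filter_upwards [hfin] with y hy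
      rw [mul_assoc, div_mul_div_mul_mul (hFle _ _) (hHle _ _) hy.ne]
    rw [← lintegral_indicator hC', ← lintegral_indicator_one (hC'.inter (hD₁.inter hD₂))]
    refine Eq.trans ?_ (e₂.trans (e₃.trans (e₁.symm.trans ?_)))
    · refine lintegral_congr fun ω => ?_
      by_cases hω : subvector Y T ω ∈ C
      · have : r T (fun v => Y v ω) ∈ C := hω
        simp [hω, this]
      · have : r T (fun v => Y v ω) ∉ C := hω
        simp [hω, this]
    · refine lintegral_congr fun ω => ?_
      change C.indicator 1 (subvector Y T ω) * _ * _ = _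
      rw [Set.inter_indicator_one, Set.inter_indicator_one, Pi.mul_apply, Pi.mul_apply, mul_assoc]
      rfl
  rw [CondIndepGiven, condIndepFun_iff_condExp_inter_preimage_eq_mul (measurable_subvector hY S)
    (measurable_subvector hY U)]
  intro s t hs ht
  have c₁ := hcond hs .univ
  have c₂ := hcond .univ ht
  rw [Set.preimage_univ, Set.inter_univ] at c₁
  rw [Set.preimage_univ, Set.univ_inter] at c₂
  filter_upwards [hcond hs ht, c₁, c₂] with ω h₁ h₂ h₃
  rw [← h₁, ← h₂, ← h₃, ← ENNReal.toReal_mul]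
  congr 1
  simp only [q]
  -- Inserting the factors `F univ / F univ` and `H univ / H univ` turns `q s t` into `q s univ * q
  -- univ t`.
  conv_lhs => rw [← div_mul_div_self (hFle s _), ← div_mul_div_self (hHle t _)]
  ring

theorem indepFun_of_condIndepGiven_empty {Ω : Type*} [MeasurableSpace Ω] [StandardBorelSpace Ω]
    {P : Measure Ω} [IsProbabilityMeasure P] {Y : ∀ v, Ω → E v} {hY : ∀ v, Measurable (Y v)}
    {S U : Set V} (h : CondIndepGiven P Y hY S U ∅) :
    IndepFun (subvector Y S) (subvector Y U) P := by
  have hS := measurable_subvector hY S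
  have hU := measurable_subvector hY U
  rw [CondIndepGiven, condIndepFun_iff_condExp_inter_preimage_eq_mul hS hU] at h
  have hbot : MeasurableSpace.comap (subvector Y (∅ : Set V)) inferInstance = ⊥ := by
    have : subvector Y (∅ : Set V) = fun _ v => v.2.elim := by
      ext ω v
      exact v.2.elim
    rw [this, MeasurableSpace.comap_const]
  rw [indepFun_iff_measure_inter_preimage_eq_mul]
  intro s t hs ht
  have := h s t hs ht
  simp only [hbot, condExp_bot, integral_indicator_const _ (hS hs), integral_indicator_const _ (hU ht),
    integral_indicator_const _ ((hS hs).inter (hU ht)), smul_eq_mul, mul_one] at this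
  -- Over the trivial σ-algebra both sides are constants, so one point at which they agree suffices.
  obtain ⟨ω, hω⟩ := this.exists
  rw [Measure.real, Measure.real, Measure.real, ← ENNReal.toReal_mul,
    ENNReal.toReal_eq_toReal_iff' (by finiteness) (by finiteness)] at hω
  exact hω

theorem IsFamilyCover.condIndepGiven [Fintype V] {G : Digraph V} (hG : IsDAG G) {A B N : Set V}
    (hc : IsFamilyCover G A B N) (ν : ∀ v, Measure (E v)) [∀ v, SigmaFinite (ν v)]
    {Ω : Type*} [MeasurableSpace Ω] [StandardBorelSpace Ω] (P : Measure Ω) [IsProbabilityMeasure P]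
    (Y : ∀ v, Ω → E v) (hY : ∀ v, Measurable (Y v))
    (hP : MarkovFactorization G ν (P.map (fun ω v => Y v ω))) :
    CondIndepGiven P Y hY (A \ B) (B \ A) (A ∩ B) := by
  classical
  obtain ⟨k, hkm, hk, hP⟩ := hP
  let d : V → (∀ v, E v) → ℝ≥0∞ := fun v x => k v (x v) (fun u => x u)
  have hd : ∀ v, Measurable (d v) := fun v =>
    (hkm v).comp ((measurable_pi_apply v).prodMk
      (measurable_pi_lambda _ fun u => measurable_pi_apply _))
  have hdep : ∀ v, DependsOn (d v) (insert v {u | G.Adj u v}) := fun v x y h => by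
    have h₁ : x v = y v := h v (Set.mem_insert _ _)
    have h₂ : (fun u : {u // G.Adj u v} => x u) = fun u : {u // G.Adj u v} => y u :=
      funext fun u => h u (Set.mem_insert_of_mem _ u.2)
    simp only [d, h₁, h₂]
  have hone : ∀ v x, ∫⁻ t, d v (Function.update x v t) ∂ν v = 1 := fun v x => by
    rw [← hk v fun u => x u]
    refine lintegral_congr fun t => ?_
    have h₂ : (fun u : {u // G.Adj u v} => Function.update x v t u) =
        fun u : {u // G.Adj u v} => x u := funext fun u => Function.update_of_ne (by
      rintro huv
      have hu := u.2
      rw [huv] at hu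
      exact hG v (.single hu)) _ _
    simp only [d, h₂, Function.update_self]
  have hprod : ∀ s : Finset V, Measurable fun x => ∏ v ∈ s, d v x := fun s =>
    Finset.measurable_fun_prod s fun v _ => hd v
  have hRc : (A ∪ B)ᶜ.toFinset =
      ((A ∩ B).toFinset ∪ ((A \ B).toFinset ∪ (B \ A).toFinset))ᶜ := by
    ext v
    simp only [Set.mem_toFinset, Finset.mem_compl, Finset.mem_union, Set.mem_compl_iff,
      Set.mem_union, Set.mem_inter_iff, Set.mem_sdiff]
    tauto
  have key := condIndepGiven_of_density ν P Y hY (S := (A \ B).toFinset) (U := (B \ A).toFinset)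
    (T := (A ∩ B).toFinset) (R := (A ∪ B)ᶜ.toFinset)
    (f := fun x => ∏ v ∈ N.toFinset, d v x) (g := fun x => ∏ v ∈ (B \ N).toFinset, d v x)
    (h := fun x => ∏ v ∈ (A ∪ B)ᶜ.toFinset, d v x)
    (by rw [Set.disjoint_toFinset, Set.disjoint_left]; exact fun v h h' => h.2 h'.1)
    (by rw [Set.disjoint_toFinset, Set.disjoint_left]; exact fun v h h' => h.2 h'.2)
    (by rw [Set.disjoint_toFinset, Set.disjoint_left]; exact fun v h h' => h.2 h'.1)
    hRc (hprod _) (hprod _) (hprod _)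
    (dependsOn_prod fun v hv => (hdep v).mono ?_)
    (dependsOn_prod fun v hv => (hdep v).mono ?_)
    (lmarginal_prod_eq_one hG hd hdep hone _) ?_
  · simpa only [Set.coe_toFinset] using key
  · rw [Set.coe_toFinset, Set.coe_toFinset, Set.inter_union_sdiff]
    rw [Set.mem_toFinset] at hv
    exact Set.insert_subset (hc.subset_left hv) fun u hu => hc.parent_left hu hv
  · rw [Set.coe_toFinset, Set.coe_toFinset, Set.inter_comm, Set.inter_union_sdiff]
    rw [Set.mem_toFinset] at hv
    exact Set.insert_subset hv.1 fun u hu => hc.parent_right hu hv.1 hv.2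
  · rw [hP]
    congr 1
    ext x
    have h₁ : Disjoint N.toFinset (B \ N).toFinset := by
      rw [Set.disjoint_toFinset]
      exact Set.disjoint_sdiff_right
    have h₂ : N.toFinset ∪ (B \ N).toFinset = (A ∪ B).toFinset := by
      ext v
      have := @hc.subset_left v
      have := @hc.diff_subset v
      simp only [Set.mem_sdiff] at this
      simp only [Set.mem_toFinset, Finset.mem_union, Set.mem_union, Set.mem_sdiff]
      tauto
    rw [← Finset.prod_union h₁, h₂, Set.toFinset_compl, Finset.prod_mul_prod_compl]

end Independence

end CutModules

theorem lemma3 {V : Type*} [Fintype V] (G : Digraph V) (hG : CutModules.IsDAG G)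
    (X XA XB : Set V) (hdisj : Disjoint XA XB) (hunion : XA ∪ XB = X)
    (A B : Set V) (hA : A = CutModules.moduleOf G X XA) (hB : B = CutModules.moduleOf G X XB)
    {E : V → Type*} [∀ v, MeasurableSpace (E v)]
    (ν : ∀ v, Measure (E v)) [∀ v, SigmaFinite (ν v)]
    {Ω : Type*} [MeasurableSpace Ω] [StandardBorelSpace Ω] (P : Measure Ω) [IsProbabilityMeasure P]
    (Y : ∀ v, Ω → E v) (hY : ∀ v, Measurable (Y v))
    (hP : CutModules.MarkovFactorization G ν (P.map (fun ω v => Y v ω))) :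
    CutModules.DSeparates G (A ∩ B) (A \ B) (B \ A) ∧
    CutModules.CondIndepGiven P Y hY (A \ B) (B \ A) (A ∩ B) ∧
    (CutModules.Unordered G A B →
      A ∩ B = ∅ ∧
      IndepFun (CutModules.subvector Y (A \ B)) (CutModules.subvector Y (B \ A)) P) := by
  subst hA hB
  have hc := CutModules.isFamilyCover_moduleOf (G := G) hdisj hunion
  have hind := hc.condIndepGiven hG ν P Y hY hP
  refine ⟨hc.dSeparates hG, hind, fun hun => ?_⟩
  have hempty := CutModules.inter_eq_empty_of_unordered hG hdisj hun
  rw [hempty] at hind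
  exact ⟨hempty, CutModules.indepFun_of_condIndepGiven_empty hind⟩
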